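/- Let $G$ be a second countable locally compact group acting continuously on a compact metrizable space $X$, let $\mu$ be a Borel probability measure on $G$, and let $p>1$. Let $\beta=\mu^{\otimes\mathbb N^*}$ be the product measure on the space $B=G^{\mathbb N^*}$ of sequences $b=(b_1,b_2,\ldots)$. A Borel probability measure $\nu$ on $X$ is called $\mu$-stationary if $\mu*\nu=\nu$, where $\mu*\nu$ is the image of $\mu\otimes\nu$ under $(g,x)\mapsto gx$. Let $\sigma\colon G\times X\to\mathbb R$ be a continuous function such that $\sigma_{\sup}(g):=\sup_{x\in X}|\sigma(g,x)|$ satisfies $\int_G\sigma_{\sup}(g)^p\,\mathrm d\mu(g)<\infty$, and let $$\sigma^+_\mu=\sup_\nu\int_{G\times X}\sigma(g,x)\,\mathrm d\mu(g)\,\mathrm d\nu(x),\qquad \sigma^-_\mu=\inf_\nu\int_{G\times X}\sigma(g,x)\,\mathrm d\mu(g)\,\mathrm d\nu(x),$$ where $\nu$ runs over the $\mu$-stationary Borel probability measures on $X$. Then, for every $\varepsilon>0$, there exist constants $D_n\ge 0$ $(n\ge 1)$, not depending on $x$, such that $$\sum_{n\ge1}n^{p-2}D_n<\infty$$ and, for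 all $n\ge1$ and all $x\in X$, $$\beta\Bigl(\Bigl\{b\in B : \frac1n\sum_{k=1}^n\sigma(b_k,b_{k-1}\cdots b_1x)\notin[\sigma^-_\mu-\varepsilon,\sigma^+_\mu+\varepsilon]\Bigr\}\Bigr)\le D_n.$$ In particular, when $\sigma$ is a cocycle, i.e. $\sigma(gg',x)=\sigma(g,g'x)+\sigma(g',x)$ for all $g,g'\in G$ and $x\in X$, one has, with the same constants $D_n$, for all $n\ge1$ and all $x\in X$, $$\mu^{*n}\Bigl(\Bigl\{g\in G : \frac{\sigma(g,x)}n\notin[\sigma^-_\mu-\varepsilon,\sigma^+_\mu+\varepsilon]\Bigr\}\Bigr)\le D_n,$$ where $\mu^{*n}=\mu*\cdots*\mu$ is the $n$-th convolution power of $\mu$. -/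

import Mathlib

open MeasureTheory Set

namespace RandomWalk

noncomputable section

/-- The one-sided Bernoulli measure `β = μ^{⊗ ℕ*}` on the space of sequences
`b = (b_1, b_2, …)`. Sequences are indexed from `0`: the coordinate `b i` is the
letter `b_{i+1}`. -/
def bernoulli {G : Type*} [MeasurableSpace G] (μ : Measure G) [IsProbabilityMeasure μ] :
    Measure (ℕ → G) :=
  Measure.infinitePi fun _ : ℕ => μ

/-- The left random walk: `walk b n = b_n ⋯ b_2 b_1`, and `walk b 0 = 1`. -/
def walk {G : Type*} [Monoid G] (b : ℕ → G) : ℕ → G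
  | 0 => 1
  | n + 1 => b n * walk b n

/-- The Birkhoff average `(1 / n) ∑_{k=1}^n σ(b_k, b_{k-1} ⋯ b_1 x)`.
The summation index `i` stands for `k - 1`, so that `b i` is the letter `b_k`. -/
def ergodicAverage {G X : Type*} [Monoid G] [MulAction G X] (σ : G × X → ℝ) (n : ℕ) (x : X)
    (b : ℕ → G) : ℝ :=
  (∑ i ∈ Finset.range n, σ (b i, walk b i • x)) / n

/-- The `n`-th convolution power `μ^{*n}`. -/
def convPow {G : Type*} [Monoid G] [MeasurableSpace G] (μ : Measure G) : ℕ → Measure G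
  | 0 => Measure.dirac 1
  | n + 1 => Measure.mconv μ (convPow μ n)

/-- The convolution `μ * ν` of a measure on `G` with a measure on a `G`-space `X`: the image of
`μ ⊗ ν` under the action map `(g, x) ↦ g x`. -/
def actionConv {G X : Type*} [SMul G X] [MeasurableSpace G] [MeasurableSpace X]
    (μ : Measure G) (ν : Measure X) : Measure X :=
  (μ.prod ν).map fun z : G × X => z.1 • z.2

/-- `ν` is a `μ`-stationary probability measure on `X`: `μ * ν = ν`. -/
def IsStationary {G X : Type*} [SMul G X] [MeasurableSpace G] [MeasurableSpace X]
    (μ : Measure G) (ν : Measure X) : Prop :=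
  IsProbabilityMeasure ν ∧ actionConv μ ν = ν

/-- The function `σ_sup(g) = sup_{x ∈ X} |σ(g, x)|`. -/
def supNorm {G X : Type*} (σ : G × X → ℝ) (g : G) : ℝ :=
  ⨆ x : X, ‖σ (g, x)‖

/-- The set of the averages `∫ σ d(μ ⊗ ν)`, where `ν` runs over the `μ`-stationary probability
measures on `X`. -/
def stationaryAverages {G X : Type*} [SMul G X] [MeasurableSpace G] [MeasurableSpace X]
    (μ : Measure G) (σ : G × X → ℝ) : Set ℝ :=
  {a | ∃ ν : Measure X, IsStationary μ ν ∧ a = ∫ z, σ z ∂(μ.prod ν)}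

/-- The upper average `σ⁺_μ`. -/
def upperAverage {G X : Type*} [SMul G X] [MeasurableSpace G] [MeasurableSpace X]
    (μ : Measure G) (σ : G × X → ℝ) : ℝ :=
  sSup (stationaryAverages μ σ)

/-- The lower average `σ⁻_μ`. -/
def lowerAverage {G X : Type*} [SMul G X] [MeasurableSpace G] [MeasurableSpace X]
    (μ : Measure G) (σ : G × X → ℝ) : ℝ :=
  sInf (stationaryAverages μ σ)

/-- `σ` satisfies the cocycle relation `σ(g g', x) = σ(g, g' x) + σ(g', x)`. -/
def IsCocycle {G X : Type*} [Monoid G] [MulAction G X] (σ : G × X → ℝ) : Prop :=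
  ∀ (g g' : G) (x : X), σ (g * g', x) = σ (g, g' • x) + σ (g', x)

end

end RandomWalk

namespace RandomWalk

open Filter Topology

/-! Replacing σ by -σ, only upper deviations matter. Let P be the Markov operator on C(X) and φ(x) =
∫ σ(g, x) dμ(g). As X is compact, occupation measures started from arbitrary points cluster at
stationary measures, so some Cesàro average of the P^k φ is at most σ⁺ + ε/3 everywhere
(`exists_average_drift_le`). This average differs from φ by ψ - Pψ with ψ continuous
(`exists_poisson`). Hence the sum of σ along the walk is a martingale, plus a term at most n(σ⁺ +
ε/3), plus a boundary term at most 2‖ψ‖ (`sum_trajectory_eq`).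

The martingale increments are dominated by a function Y of the letter alone, with finite p-th
moment. Truncation at δn and a Chernoff bound with parameter a log n / n (`measure_sum_gt_le`) give,
for large n, the bound n μ(Y > δn) + e n^(-p). With weight n^(p-2), the first term is summable by
the moment assumption and the second is of order n^(-2) (`exists_summable_bound_sum_gt`). -/

theorem supNorm_nonneg {G X : Type*} (σ : G × X → ℝ) (g : G) : 0 ≤ supNorm σ g :=
  Real.iSup_nonneg fun _ => norm_nonneg _

theorem supNorm_neg {G X : Type*} (σ : G × X → ℝ) : supNorm (-σ) = supNorm σ := by
  funext g
  simp [supNorm]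

theorem abs_le_supNorm {G X : Type*} [TopologicalSpace G] [TopologicalSpace X]
    [CompactSpace X] {σ : G × X → ℝ} (hσ : Continuous σ) (g : G) (x : X) :
    |σ (g, x)| ≤ supNorm σ g := by
  have hc : Continuous fun x => ‖σ (g, x)‖ := by fun_prop
  exact le_ciSup (isCompact_range hc).bddAbove x

/-- Currying σ gives a continuous map from G to C(X, ℝ) with the sup norm. The measurability of the
dominating function comes from here. -/
theorem continuous_supNorm {G X : Type*} [TopologicalSpace G] [TopologicalSpace X]
    [CompactSpace X] {σ : G × X → ℝ} (hσ : Continuous σ) : Continuous (supNorm σ) := by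
  have h := ContinuousMap.continuous (ContinuousMap.curry ⟨σ, hσ⟩)
  have h2 : supNorm σ = fun g => ‖(ContinuousMap.curry ⟨σ, hσ⟩ : C(G, C(X, ℝ))) g‖ := by
    funext g
    rw [ContinuousMap.norm_eq_iSup_norm]
    rfl
  rw [h2]
  exact continuous_norm.comp h

theorem integrable_section {G X : Type*} [TopologicalSpace G] [MeasurableSpace G] [BorelSpace G]
    [TopologicalSpace X] [CompactSpace X] {μ : Measure G} {σ : G × X → ℝ} (hσ : Continuous σ)
    (hi : Integrable (supNorm σ) μ) (x : X) : Integrable (fun g => σ (g, x)) μ := by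
  have hc : Continuous fun g => σ (g, x) := by fun_prop
  exact hi.mono' hc.measurable.aestronglyMeasurable
    (Eventually.of_forall fun g => abs_le_supNorm hσ g x)

theorem integrable_comp_smul {G X : Type*} [Monoid G] [TopologicalSpace G] [MeasurableSpace G]
    [BorelSpace G] [TopologicalSpace X] [CompactSpace X] [MulAction G X] [ContinuousSMul G X]
    {μ : Measure G} [IsFiniteMeasure μ] (f : C(X, ℝ)) (x : X) :
    Integrable (fun g : G => f (g • x)) μ := by
  have hc : Continuous fun g : G => f (g • x) := by fun_prop
  exact Integrable.of_bound hc.measurable.aestronglyMeasurable ‖f‖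
    (Eventually.of_forall fun g => f.norm_coe_le_norm _)

theorem bddAbove_stationaryAverages {G X : Type*} [SMul G X] [TopologicalSpace G] [SecondCountableTopology G]
    [MeasurableSpace G] [BorelSpace G] [TopologicalSpace X] [CompactSpace X]
    [MeasurableSpace X] [BorelSpace X]
    {μ : Measure G} [IsProbabilityMeasure μ]
    {σ : G × X → ℝ} (hσ : Continuous σ) (hi : Integrable (supNorm σ) μ) :
    BddAbove (stationaryAverages μ σ) := by
  refine ⟨∫ g, supNorm σ g ∂μ, ?_⟩
  rintro _ ⟨ν, ⟨hν, -⟩, rfl⟩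
  have h1 : Integrable (fun z : G × X => supNorm σ z.1) (μ.prod ν) := hi.comp_fst ν
  have h2 : Integrable σ (μ.prod ν) := h1.mono' hσ.measurable.aestronglyMeasurable
    (Eventually.of_forall fun z => abs_le_supNorm hσ z.1 z.2)
  refine (integral_mono h2 h1 fun z => (le_abs_self _).trans (abs_le_supNorm hσ z.1 z.2)).trans ?_
  rw [integral_prod _ h1]
  simp

/-! ### Markov operator, occupation measures and the Poisson equation -/

section MarkovOperator

variable {G : Type*} [Monoid G] [TopologicalSpace G]
  [SecondCountableTopology G] [MeasurableSpace G] [BorelSpace G]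
  {X : Type*} [TopologicalSpace X] [CompactSpace X] [TopologicalSpace.MetrizableSpace X]
  [MeasurableSpace X] [BorelSpace X]

/-- The mean `x ↦ ∫ σ(g, x) dμ(g)` of a function that is integrable uniformly in `x`. -/
noncomputable def drift (μ : Measure G) (σ : G × X → ℝ) (hσ : Continuous σ)
    (hi : Integrable (supNorm σ) μ) : C(X, ℝ) where
  toFun x := ∫ g, σ (g, x) ∂μ
  continuous_toFun := by
    refine continuous_of_dominated (bound := supNorm σ) (fun x => ?_)
      (fun x => Eventually.of_forall fun g => abs_le_supNorm hσ g x) hi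
      (Eventually.of_forall fun g => by fun_prop)
    exact (integrable_section hσ hi x).aestronglyMeasurable

variable [MulAction G X] [ContinuousSMul G X]

/-- The Markov operator `P f (x) = ∫ f(g x) dμ(g)` of the random walk on `X`. -/
noncomputable def markovOp (μ : Measure G) [IsFiniteMeasure μ] : C(X, ℝ) →ₗ[ℝ] C(X, ℝ) where
  toFun f :=
    { toFun := fun x => ∫ g : G, f (g • x) ∂μ
      continuous_toFun := by
        refine continuous_of_dominated (bound := fun _ => ‖f‖) (fun x => ?_)
          (fun x => Eventually.of_forall fun g => f.norm_coe_le_norm _) (integrable_const _)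
          (Eventually.of_forall fun g => by fun_prop)
        exact (integrable_comp_smul f x).aestronglyMeasurable }
  map_add' f f' := by
    ext x
    exact integral_add (integrable_comp_smul f x) (integrable_comp_smul f' x)
  map_smul' c f := by
    ext x
    exact integral_const_mul c _

theorem markovOp_apply (μ : Measure G) [IsFiniteMeasure μ] (f : C(X, ℝ)) (x : X) :
    markovOp μ f x = ∫ g : G, f (g • x) ∂μ := rfl

theorem norm_markovOp_pow_le (μ : Measure G) [IsProbabilityMeasure μ] (f : C(X, ℝ)) (n : ℕ) :
    ‖(markovOp μ ^ n) f‖ ≤ ‖f‖ := by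
  induction n with
  | zero => simp
  | succ n ih =>
    rw [pow_succ', Module.End.mul_apply]
    refine le_trans ?_ ih
    refine (ContinuousMap.norm_le _ (norm_nonneg _)).2 fun x => ?_
    rw [markovOp_apply]
    simpa using norm_integral_le_of_norm_le_const (μ := μ) (C := ‖(markovOp μ ^ n) f‖)
      (Eventually.of_forall fun g : G => ((markovOp μ ^ n) f).norm_coe_le_norm (g • x))

theorem measurable_smul_prod : Measurable fun z : G × X => z.1 • z.2 :=
  continuous_smul.measurable

instance isProbabilityMeasure_actionConv (μ : Measure G) (ν : Measure X) [IsProbabilityMeasure μ]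
    [IsProbabilityMeasure ν] : IsProbabilityMeasure (actionConv μ ν) :=
  Measure.isProbabilityMeasure_map measurable_smul_prod.aemeasurable

theorem integral_actionConv (μ : Measure G) (ν : Measure X) [IsProbabilityMeasure μ]
    [IsProbabilityMeasure ν] (f : C(X, ℝ)) :
    ∫ x, f x ∂(actionConv μ ν) = ∫ x, markovOp μ f x ∂ν := by
  rw [actionConv, integral_map measurable_smul_prod.aemeasurable
    f.continuous.measurable.aestronglyMeasurable, integral_prod_symm]
  · rfl
  · have hc : Continuous fun z : G × X => f (z.1 • z.2) := by fun_prop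
    exact Integrable.of_bound hc.measurable.aestronglyMeasurable ‖f‖
      (Eventually.of_forall fun g => f.norm_coe_le_norm _)

/-- The law `P^n δ_x` of the `n`-th step of the random walk starting from `x`. -/
noncomputable def stepLaw (μ : Measure G) (x : X) : ℕ → Measure X
  | 0 => Measure.dirac x
  | n + 1 => actionConv μ (stepLaw μ x n)

instance isProbabilityMeasure_stepLaw (μ : Measure G) [IsProbabilityMeasure μ] (x : X) (n : ℕ) :
    IsProbabilityMeasure (stepLaw μ x n) := by
  induction n with
  | zero => exact Measure.dirac.isProbabilityMeasure
  | succ n ih => exact isProbabilityMeasure_actionConv μ _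

theorem integral_stepLaw (μ : Measure G) [IsProbabilityMeasure μ] (x : X) (n : ℕ) (f : C(X, ℝ)) :
    ∫ y, f y ∂(stepLaw μ x n) = (markovOp μ ^ n) f x := by
  induction n generalizing f with
  | zero => simp [stepLaw, integral_dirac' _ _ f.continuous.measurable.stronglyMeasurable]
  | succ n ih =>
    rw [stepLaw, integral_actionConv, ih, pow_succ, Module.End.mul_apply]

/-- The occupation measure `(n + 1)⁻¹ ∑_{k ≤ n} P^k δ_x`. -/
noncomputable def occupation (μ : Measure G) (x : X) (n : ℕ) : Measure X :=
  ((n + 1 : ℕ) : ENNReal)⁻¹ • ∑ k ∈ Finset.range (n + 1), stepLaw μ x k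

instance isProbabilityMeasure_occupation (μ : Measure G) [IsProbabilityMeasure μ] (x : X)
    (n : ℕ) : IsProbabilityMeasure (occupation μ x n) := by
  constructor
  simp only [occupation, Measure.smul_apply, Measure.finsetSum_apply, measure_univ,
    Finset.sum_const, Finset.card_range, smul_eq_mul, nsmul_eq_mul, mul_one]
  exact ENNReal.inv_mul_cancel (by simp) (ENNReal.natCast_ne_top _)

theorem integral_occupation (μ : Measure G) [IsProbabilityMeasure μ] (x : X) (n : ℕ)
    (f : C(X, ℝ)) : ∫ y, f y ∂(occupation μ x n) =
      ((n + 1 : ℕ) : ℝ)⁻¹ * ∑ k ∈ Finset.range (n + 1), (markovOp μ ^ k) f x := by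
  rw [occupation, integral_smul_measure, integral_finsetSum_measure]
  · have h : (((n + 1 : ℕ) : ENNReal)⁻¹).toReal = ((n + 1 : ℕ) : ℝ)⁻¹ := by
      rw [ENNReal.toReal_inv, ENNReal.toReal_natCast]
    simp only [integral_stepLaw, h, smul_eq_mul]
  · intro k _
    exact Integrable.of_bound f.continuous.measurable.aestronglyMeasurable ‖f‖
      (Eventually.of_forall fun g => f.norm_coe_le_norm _)

theorem integral_drift_le_upperAverage {μ : Measure G} [IsProbabilityMeasure μ] {σ : G × X → ℝ}
    (hσ : Continuous σ) (hi : Integrable (supNorm σ) μ) {ν : Measure X} (hν : IsStationary μ ν) :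
    ∫ x, drift μ σ hσ hi x ∂ν ≤ upperAverage μ σ := by
  refine le_csSup (bddAbove_stationaryAverages hσ hi) ⟨ν, hν, ?_⟩
  have := hν.1
  have h1 : Integrable (fun z : G × X => supNorm σ z.1) (μ.prod ν) := hi.comp_fst ν
  have h2 : Integrable σ (μ.prod ν) := h1.mono' hσ.measurable.aestronglyMeasurable
    (Eventually.of_forall fun z => abs_le_supNorm hσ z.1 z.2)
  rw [integral_prod_symm _ h2]
  rfl

/-- Every sequence of starting points has a stationary measure among the cluster points of its
occupation measures. -/
theorem exists_stationary_tendsto_occupation (μ : Measure G) [IsProbabilityMeasure μ]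
    (x : ℕ → X) : ∃ ν : Measure X, IsStationary μ ν ∧ ∀ f : C(X, ℝ),
      Tendsto (fun n => ∫ y, f y ∂(occupation μ (x n) n)) (hyperfilter ℕ) (𝓝 (∫ y, f y ∂ν)) := by
  let u : ℕ → ProbabilityMeasure X := fun n => ⟨occupation μ (x n) n, inferInstance⟩
  -- An ultrafilter replaces the extraction of a weakly convergent subsequence.
  obtain ⟨ν, -, hν⟩ := isCompact_univ.ultrafilter_le_nhds ((hyperfilter ℕ).map u) (by simp)
  have hlim : ∀ f : C(X, ℝ), Tendsto (fun n => ∫ y, f y ∂(occupation μ (x n) n))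
      (hyperfilter ℕ) (𝓝 (∫ y, f y ∂(ν : Measure X))) := fun f =>
    (ProbabilityMeasure.tendsto_iff_forall_integral_tendsto.1 (show Tendsto u _ _ from hν))
      (BoundedContinuousFunction.mkOfCompact f)
  refine ⟨ν, ⟨inferInstance, ?_⟩, hlim⟩
  refine ext_of_forall_integral_eq_of_IsFiniteMeasure fun f => ?_
  let f' : C(X, ℝ) := f.toContinuousMap
  change ∫ y, f' y ∂_ = ∫ y, f' y ∂_
  rw [integral_actionConv]
  -- Stationarity of the limit: the integrals of P f and f against the occupation measures differ by
  -- a telescoping sum of size O(1/n).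
  have h := (hlim (markovOp μ f')).sub (hlim f')
  have h0 : Tendsto (fun n => ∫ y, markovOp μ f' y ∂(occupation μ (x n) n) -
      ∫ y, f' y ∂(occupation μ (x n) n)) (hyperfilter ℕ) (𝓝 0) := by
    refine Tendsto.mono_left ?_ (Nat.hyperfilter_le_atTop)
    have hb : Tendsto (fun n : ℕ => ((n + 1 : ℕ) : ℝ)⁻¹ * (2 * ‖f'‖)) atTop (𝓝 0) := by
      have := (tendsto_inv_atTop_nhds_zero_nat (𝕜 := ℝ)).comp (tendsto_add_atTop_nat 1)
      simpa using this.mul_const (2 * ‖f'‖)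
    refine squeeze_zero_norm (fun n => ?_) hb
    rw [integral_occupation, integral_occupation, ← mul_sub, ← Finset.sum_sub_distrib]
    have : ∀ k, (markovOp μ ^ k) (markovOp μ f') (x n) = (markovOp μ ^ (k + 1)) f' (x n) := by
      intro k
      rw [pow_succ, Module.End.mul_apply]
    simp only [this]
    rw [Finset.sum_range_sub (fun k => (markovOp μ ^ k) f' (x n)), norm_mul, norm_inv,
      RCLike.norm_natCast]
    gcongr
    calc _ ≤ ‖(markovOp μ ^ (n + 1)) f' (x n)‖ + ‖(markovOp μ ^ 0) f' (x n)‖ := norm_sub_le _ _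
      _ ≤ ‖f'‖ + ‖f'‖ := add_le_add
        ((ContinuousMap.norm_coe_le_norm _ _).trans (norm_markovOp_pow_le μ f' _))
        ((ContinuousMap.norm_coe_le_norm _ _).trans (norm_markovOp_pow_le μ f' _))
      _ = 2 * ‖f'‖ := by ring
  exact sub_eq_zero.1 (tendsto_nhds_unique h h0)

/-- If every n had a bad starting point x_n, a limit of the occupation measures from the x_n would
be a stationary measure with average at least σ⁺ + ε. -/
theorem exists_average_drift_le {μ : Measure G} [IsProbabilityMeasure μ] {σ : G × X → ℝ}
    (hσ : Continuous σ) (hi : Integrable (supNorm σ) μ) {ε : ℝ} (hε : 0 < ε) :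
    ∃ n : ℕ, ∀ x : X, ((n + 1 : ℕ) : ℝ)⁻¹ *
      ∑ k ∈ Finset.range (n + 1), (markovOp μ ^ k) (drift μ σ hσ hi) x ≤
        upperAverage μ σ + ε := by
  by_contra! h
  choose x hx using h
  obtain ⟨ν, hν, hlim⟩ := exists_stationary_tendsto_occupation μ x
  have h1 := integral_drift_le_upperAverage hσ hi hν
  have h2 := ge_of_tendsto (hlim (drift μ σ hσ hi)) (b := upperAverage μ σ + ε)
    (Eventually.of_forall fun n => by rw [integral_occupation]; exact (hx n).le)
  linarith

/-- 1 - P^k is divisible by 1 - P, with quotient the sum of the P^j for j < k; ψ averages these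
quotients, applied to φ, over k ≤ n. -/
theorem exists_poisson (μ : Measure G) [IsProbabilityMeasure μ] (φ : C(X, ℝ)) (n : ℕ) :
    ∃ ψ : C(X, ℝ), ∀ x, ψ x - markovOp μ ψ x =
      φ x - ((n + 1 : ℕ) : ℝ)⁻¹ * ∑ k ∈ Finset.range (n + 1), (markovOp μ ^ k) φ x := by
  refine ⟨((n + 1 : ℕ) : ℝ)⁻¹ • ∑ k ∈ Finset.range (n + 1), ∑ j ∈ Finset.range k,
    (markovOp μ ^ j) φ, fun x => ?_⟩
  have key : ∀ k, (∑ j ∈ Finset.range k, (markovOp μ ^ j) φ) -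
      markovOp μ (∑ j ∈ Finset.range k, (markovOp μ ^ j) φ) = φ - (markovOp μ ^ k) φ := by
    intro k
    rw [map_sum, ← Finset.sum_sub_distrib]
    have := Finset.sum_range_sub' (fun j => (markovOp μ ^ j) φ) k
    simpa [pow_succ', Module.End.mul_apply] using this
  rw [← ContinuousMap.sub_apply, map_smul, ← smul_sub, map_sum, ← Finset.sum_sub_distrib]
  simp only [key, Finset.sum_sub_distrib, Finset.sum_const, Finset.card_range]
  simp only [ContinuousMap.smul_apply, ContinuousMap.sub_apply, ContinuousMap.sum_apply,
    smul_eq_mul, nsmul_eq_mul, ContinuousMap.mul_apply, ContinuousMap.natCast_apply]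
  have : ((n + 1 : ℕ) : ℝ) ≠ 0 := by positivity
  field_simp

end MarkovOperator

/-! ### Bernoulli measure, the shift, and the law of the walk -/

/-- The sequence with first letter `z.1` followed by `z.2`. -/
def consSeq {G : Type*} (z : G × (ℕ → G)) : ℕ → G
  | 0 => z.1
  | n + 1 => z.2 n

theorem walk_consSeq {G : Type*} [Monoid G] (g : G) (b : ℕ → G) (n : ℕ) :
    walk (consSeq (g, b)) (n + 1) = walk b n * g := by
  induction n with
  | zero => simp [walk, consSeq]
  | succ n ih =>
    rw [walk, ih, walk, mul_assoc]
    rfl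

section Bernoulli

variable {G : Type*} [MeasurableSpace G]

theorem measurable_consSeq : Measurable (consSeq : G × (ℕ → G) → ℕ → G) := by
  refine measurable_pi_lambda _ fun n => ?_
  cases n with
  | zero => exact measurable_fst
  | succ n => exact (measurable_pi_apply n).comp measurable_snd

instance isProbabilityMeasure_bernoulli (μ : Measure G) [IsProbabilityMeasure μ] :
    IsProbabilityMeasure (bernoulli μ) := by
  unfold bernoulli; infer_instance

theorem map_consSeq (μ : Measure G) [IsProbabilityMeasure μ] :
    (μ.prod (bernoulli μ)).map consSeq = bernoulli μ := by
  refine Measure.eq_infinitePi _ fun s t ht => ?_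
  classical
  have hpre : ∀ N : ℕ, ∀ t : ℕ → Set G, (∀ i, MeasurableSet (t i)) →
      (μ.prod (bernoulli μ)).map consSeq (Set.pi (Finset.range (N + 1)) t) =
        ∏ i ∈ Finset.range (N + 1), μ (t i) := by
    intro N t ht
    rw [Measure.map_apply measurable_consSeq
      (MeasurableSet.pi (Finset.countable_toSet _) fun i _ => ht i)]
    have : consSeq ⁻¹' (Set.pi (Finset.range (N + 1)) t) =
        t 0 ×ˢ Set.pi (Finset.range N) fun i => t (i + 1) := by
      ext z
      simp only [mem_preimage, Set.mem_pi, Finset.coe_range, mem_Iio, mem_prod]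
      constructor
      · intro h
        exact ⟨h 0 (by omega), fun i hi => h (i + 1) (by omega)⟩
      · rintro ⟨h0, h⟩ i hi
        cases i with
        | zero => exact h0
        | succ i => exact h i (by omega)
    rw [this, Measure.prod_prod, bernoulli, Measure.infinitePi_pi _ fun i _ => ht _,
      Finset.prod_range_succ', mul_comm]
  -- Any finite set of coordinates is enlarged to an initial segment, with `univ` at the new ones.
  obtain ⟨N, hN⟩ : ∃ N, s ⊆ Finset.range (N + 1) :=
    ⟨s.sup id, fun i hi => Finset.mem_range_succ_iff.2 (Finset.le_sup (f := id) hi)⟩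
  have h := hpre N (fun i => if i ∈ s then t i else univ) fun i => by
    split_ifs <;> simp [ht]
  have h1 : Set.pi (Finset.range (N + 1)) (fun i => if i ∈ s then t i else univ) =
      Set.pi (s : Set ℕ) t := by
    ext b
    simp only [Set.mem_pi, Finset.mem_coe]
    constructor
    · intro h i hi
      simpa [hi] using h i (hN hi)
    · intro h i _
      by_cases hi : i ∈ s
      · simpa [hi] using h i hi
      · simp [hi]
  rw [h1] at h
  rw [h, ← Finset.prod_subset hN]
  · exact Finset.prod_congr rfl fun i hi => by simp [hi]
  · intro i _ hi
    simp [hi]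

theorem lintegral_bernoulli (μ : Measure G) [IsProbabilityMeasure μ] {F : (ℕ → G) → ENNReal}
    (hF : Measurable F) :
    ∫⁻ b, F b ∂(bernoulli μ) = ∫⁻ g, ∫⁻ b, F (consSeq (g, b)) ∂(bernoulli μ) ∂μ := by
  conv_lhs => rw [← map_consSeq μ]
  rw [lintegral_map hF measurable_consSeq,
    lintegral_prod (fun z => F (consSeq z)) (hF.comp measurable_consSeq).aemeasurable]

theorem bernoulli_eval (μ : Measure G) [IsProbabilityMeasure μ] (i : ℕ) {s : Set G}
    (hs : MeasurableSet s) : bernoulli μ {b | b i ∈ s} = μ s :=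
  (measurePreserving_eval_infinitePi (fun _ : ℕ => μ) i).measure_preimage hs.nullMeasurableSet

theorem measurable_walk [Monoid G] [MeasurableMul₂ G] (n : ℕ) :
    Measurable fun b : ℕ → G => walk b n := by
  induction n with
  | zero => exact measurable_const
  | succ n ih => exact (measurable_pi_apply n).mul ih

/-- `convPow` adds factors on the left, whereas splitting off the first letter of a sequence removes
the rightmost factor of the walk. -/
theorem convPow_succ' [Monoid G] [MeasurableMul₂ G] (μ : Measure G) [IsProbabilityMeasure μ]
    (n : ℕ) : convPow μ (n + 1) = Measure.mconv (convPow μ n) μ ∧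
      IsProbabilityMeasure (convPow μ n) := by
  induction n with
  | zero =>
    refine ⟨?_, Measure.dirac.isProbabilityMeasure⟩
    simp [convPow]
  | succ n ih =>
    have := ih.2
    have h2 : IsProbabilityMeasure (convPow μ (n + 1)) := by
      rw [convPow]; infer_instance
    refine ⟨?_, h2⟩
    change Measure.mconv μ (convPow μ (n + 1)) = _
    rw [ih.1, ← Measure.mconv_assoc, ← ih.1]
    rfl

theorem map_walk [Monoid G] [MeasurableMul₂ G] (μ : Measure G) [IsProbabilityMeasure μ] (n : ℕ) :
    (bernoulli μ).map (fun b => walk b n) = convPow μ n := by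
  induction n with
  | zero => simp [walk, convPow]
  | succ n ih =>
    have := (convPow_succ' μ n).2
    ext s hs
    have hm : Measurable fun z : G × G => z.1 * z.2 := measurable_mul
    have hms : MeasurableSet ((fun z : G × G => z.1 * z.2) ⁻¹' s) := hm hs
    rw [(convPow_succ' μ n).1, Measure.mconv, Measure.map_apply hm hs,
      Measure.prod_apply_symm hms, Measure.map_apply (measurable_walk _) hs,
      ← lintegral_indicator_one (measurable_walk _ hs),
      lintegral_bernoulli _ (measurable_one.indicator (measurable_walk _ hs))]
    refine lintegral_congr fun g => ?_
    rw [← ih, Measure.map_apply (measurable_walk n) (measurable_prodMk_right (y := g) hms),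
      ← lintegral_indicator_one
        (measurable_walk n (measurable_prodMk_right (y := g) hms))]
    refine lintegral_congr fun b => ?_
    change s.indicator 1 (walk (consSeq (g, b)) (n + 1)) = s.indicator 1 (walk b n * g)
    rw [walk_consSeq]

variable {X : Type*} [MeasurableSpace X] [Monoid G] [MeasurableMul₂ G] [MulAction G X]

theorem measurable_trajectory (hsm : Measurable fun z : G × X => z.1 • z.2) (i : ℕ) (x : X) :
    Measurable fun b : ℕ → G => (b i, walk b i • x) :=
  (measurable_pi_apply i).prodMk (hsm.comp ((measurable_walk i).prodMk measurable_const))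

/-- A one-step bound on the mean of a nonnegative function propagates multiplicatively along
the random walk. -/
theorem lintegral_prod_trajectory_le (hsm : Measurable fun z : G × X => z.1 • z.2)
    (μ : Measure G) [IsProbabilityMeasure μ] {F : G × X → ENNReal} (hF : Measurable F)
    {c : ENNReal} (hc : ∀ x, ∫⁻ g, F (g, x) ∂μ ≤ c) (n : ℕ) (x : X) :
    ∫⁻ b, ∏ i ∈ Finset.range n, F (b i, walk b i • x) ∂(bernoulli μ) ≤ c ^ n := by
  induction n generalizing x with
  | zero => simp
  | succ n ih =>
    have hm : ∀ n x, Measurable fun b : ℕ → G =>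
        ∏ i ∈ Finset.range n, F (b i, walk b i • x) := fun n x =>
      Finset.measurable_fun_prod _ fun i _ => hF.comp (measurable_trajectory hsm i x)
    -- Conditionally on the first letter g, the walk restarts from g • x, hence the induction for
    -- all starting points at once.
    rw [lintegral_bernoulli _ (hm _ _)]
    calc _ = ∫⁻ g, F (g, x) * ∫⁻ b, ∏ i ∈ Finset.range n, F (b i, walk b i • g • x)
            ∂(bernoulli μ) ∂μ := by
          refine lintegral_congr fun g => ?_
          rw [← lintegral_const_mul _ (hm _ _)]
          refine lintegral_congr fun b => ?_
          rw [Finset.prod_range_succ', mul_comm]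
          congr 1
          · simp [walk, consSeq]
          · refine Finset.prod_congr rfl fun i _ => ?_
            rw [walk_consSeq, mul_smul]
            rfl
      _ ≤ ∫⁻ g, F (g, x) * c ^ n ∂μ := lintegral_mono fun g => by gcongr; exact ih _
      _ ≤ c ^ (n + 1) := by
          have hFx : Measurable fun g => F (g, x) := hF.comp measurable_prodMk_right
          rw [lintegral_mul_const _ hFx, pow_succ']
          gcongr
          exact hc x

end Bernoulli

/-! ### Real estimates: truncated exponentials and tail sums -/

theorem exp_le_one_add_self_add_sq_mul_exp_abs (t : ℝ) :
    Real.exp t ≤ 1 + t + t ^ 2 * Real.exp |t| := by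
  have h := Complex.norm_exp_sub_sum_le_norm_mul_exp (t : ℂ) 2
  simp only [Finset.sum_range_succ, Finset.range_zero, Finset.sum_empty, pow_zero, pow_one,
    Nat.factorial, Nat.cast_one, div_one, zero_add, mul_one] at h
  rw [Complex.norm_real, Real.norm_eq_abs, sq_abs] at h
  have h2 : Complex.exp t - (1 + t) = ((Real.exp t - (1 + t) : ℝ) : ℂ) := by push_cast; rfl
  rw [h2, Complex.norm_real] at h
  have := (le_abs_self _).trans h
  linarith

/-- A bound for the exponential of a variable truncated at level `M`, in terms of a moment of
order `q ∈ [1, 2]`. -/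
theorem exp_truncation_le {q l M d Y : ℝ} (hq1 : 1 ≤ q) (hq2 : q ≤ 2) (hl : 0 ≤ l) (hM : 0 < M)
    (hd : |d| ≤ Y) :
    Real.exp (l * if Y ≤ M then d else 0) ≤
      1 + l * d + (l * M ^ (1 - q) + l ^ 2 * M ^ (2 - q) * Real.exp (l * M)) * Y ^ q := by
  have hY : 0 ≤ Y := (abs_nonneg d).trans hd
  have hYq : 0 ≤ Y ^ q := Real.rpow_nonneg hY _
  have hM1 : 0 ≤ M ^ (1 - q) := Real.rpow_nonneg hM.le _
  have hM2 : 0 ≤ M ^ (2 - q) := Real.rpow_nonneg hM.le _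
  split_ifs with h
  · have h1 := exp_le_one_add_self_add_sq_mul_exp_abs (l * d)
    have h2 : d ^ 2 ≤ M ^ (2 - q) * Y ^ q := by
      rcases hY.eq_or_lt with h0 | h0
      · have : d = 0 := abs_nonpos_iff.1 (hd.trans h0.symm.le)
        rw [this]
        simpa using mul_nonneg hM2 hYq
      · calc d ^ 2 ≤ Y ^ 2 := sq_le_sq' (neg_le_of_abs_le hd) (le_of_abs_le hd)
          _ = Y ^ (2 - q) * Y ^ q := by
            rw [← Real.rpow_add h0]; simp
          _ ≤ M ^ (2 - q) * Y ^ q := by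
            gcongr
    have h3 : Real.exp |l * d| ≤ Real.exp (l * M) := by
      rw [abs_mul, abs_of_nonneg hl]
      gcongr
      exact hd.trans h
    have h4 : (l * d) ^ 2 * Real.exp |l * d| ≤
        l ^ 2 * (M ^ (2 - q) * Y ^ q) * Real.exp (l * M) := by
      rw [mul_pow]
      gcongr
    have h5 : 0 ≤ l * M ^ (1 - q) * Y ^ q := by positivity
    linarith
  -- Here the left side is 1, and l * d may be negative; the term l M^(1-q) Y^q ≥ l Y compensates
  -- it.
  · have hMY : M < Y := not_le.1 h
    have h0 : 0 < Y := hM.trans hMY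
    have h2 : Y ≤ M ^ (1 - q) * Y ^ q := by
      calc Y = Y ^ (1 - q) * Y ^ q := by rw [← Real.rpow_add h0]; simp
        _ ≤ M ^ (1 - q) * Y ^ q := by
          gcongr ?_ * _
          exact Real.rpow_le_rpow_of_nonpos hM hMY.le (by linarith)
    have h3 : 0 ≤ l * (M ^ (1 - q) * Y ^ q + d) :=
      mul_nonneg hl (by linarith [neg_le_of_abs_le hd])
    have h5 : 0 ≤ l ^ 2 * M ^ (2 - q) * Real.exp (l * M) * Y ^ q := by positivity
    simp only [mul_zero, Real.exp_zero]
    linarith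

/-- At most ⌊z⌋ indices n ≥ 1 contribute, each at most z^(p-1); the index 0 has weight zero because
p > 1. -/
theorem sum_rpow_mul_indicator_le {p z : ℝ} (hp : 1 < p) (hz : 0 ≤ z) (N : ℕ) :
    ∑ n ∈ Finset.range N, (n : ℝ) ^ (p - 1) * (Ioi (n : ℝ)).indicator 1 z ≤ z ^ p := by
  have hz1 : 0 ≤ z ^ (p - 1) := Real.rpow_nonneg hz _
  calc ∑ n ∈ Finset.range N, (n : ℝ) ^ (p - 1) * (Ioi (n : ℝ)).indicator 1 z
      ≤ ∑ n ∈ Finset.range N, if n ∈ Finset.Icc 1 ⌊z⌋₊ then z ^ (p - 1) else 0 := by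
        refine Finset.sum_le_sum fun n _ => ?_
        rcases Nat.eq_zero_or_pos n with rfl | hn
        · rw [Nat.cast_zero, Real.zero_rpow (by linarith), zero_mul]
          split_ifs <;> positivity
        by_cases h : (n : ℝ) < z
        · rw [indicator_of_mem (mem_Ioi.2 h),
            if_pos (Finset.mem_Icc.2 ⟨hn, Nat.le_floor h.le⟩), Pi.one_apply, mul_one]
          exact Real.rpow_le_rpow (Nat.cast_nonneg _) h.le (by linarith)
        · rw [indicator_of_notMem (by simpa using h), mul_zero]
          split_ifs <;> positivity
    _ = ∑ n ∈ Finset.range N with n ∈ Finset.Icc 1 ⌊z⌋₊, z ^ (p - 1) := by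
        rw [Finset.sum_filter]
    _ ≤ ∑ n ∈ Finset.Icc 1 ⌊z⌋₊, z ^ (p - 1) :=
        Finset.sum_le_sum_of_subset_of_nonneg (fun n hn => (Finset.mem_filter.1 hn).2)
          fun _ _ _ => hz1
    _ = ⌊z⌋₊ * z ^ (p - 1) := by simp
    _ ≤ z * z ^ (p - 1) := by
        gcongr
        exact Nat.floor_le hz
    _ = z ^ p := by
        rcases hz.eq_or_lt with h | h
        · rw [← h, zero_mul, Real.zero_rpow (by linarith)]
        · conv_lhs => rw [← Real.rpow_one z, ← Real.rpow_mul hz, ← Real.rpow_add h]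
          congr 1
          ring

theorem summable_rpow_mul_measure_lt {Ω : Type*} [MeasurableSpace Ω] {μ : Measure Ω}
    [IsFiniteMeasure μ] {p : ℝ} (hp : 1 < p) {Y : Ω → ℝ} (hY : Measurable Y) (hY0 : ∀ ω, 0 ≤ Y ω)
    (hi : Integrable (fun ω => Y ω ^ p) μ) {δ : ℝ} (hδ : 0 < δ) :
    Summable fun n : ℕ => (n : ℝ) ^ (p - 1) * μ.real {ω | δ * n < Y ω} := by
  refine summable_of_sum_range_le (c := ∫ ω, (Y ω / δ) ^ p ∂μ) (fun n => by positivity)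
    fun N => ?_
  have hset : ∀ n : ℕ, {ω | δ * n < Y ω} = (fun ω => Y ω / δ) ⁻¹' Ioi (n : ℝ) := by
    intro n
    ext ω
    simp only [mem_ofPred_eq, mem_preimage, mem_Ioi, lt_div_iff₀ hδ, mul_comm]
  have hmeas : ∀ n : ℕ, MeasurableSet ((fun ω => Y ω / δ) ⁻¹' Ioi (n : ℝ)) := fun n =>
    hY.div_const δ measurableSet_Ioi
  have hint : ∀ n : ℕ, Integrable (fun ω => (n : ℝ) ^ (p - 1) *
      (Ioi (n : ℝ)).indicator (1 : ℝ → ℝ) (Y ω / δ)) μ := fun n =>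
    ((integrable_const (1 : ℝ)).indicator (hmeas n)).const_mul _
  have hterm : ∀ n : ℕ, (n : ℝ) ^ (p - 1) * μ.real {ω | δ * n < Y ω} =
      ∫ ω, (n : ℝ) ^ (p - 1) * (Ioi (n : ℝ)).indicator (1 : ℝ → ℝ) (Y ω / δ) ∂μ := by
    intro n
    rw [integral_const_mul, hset, ← integral_indicator_one (hmeas n)]
    rfl
  simp only [hterm]
  rw [← integral_finsetSum _ fun n _ => hint n]
  refine integral_mono (integrable_finsetSum _ fun n _ => hint n) ?_ fun ω =>
    sum_rpow_mul_indicator_le hp (div_nonneg (hY0 ω) hδ.le) N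
  simp only [Real.div_rpow (hY0 _) hδ.le]
  exact hi.div_const _

/-- With truncation level `δ n` and exponential parameter `a log n / n`, the logarithm of the
Laplace transform of a sum of `n` truncated variables tends to zero. -/
theorem tendsto_laplace_exponent {q a δ : ℝ} (hq : 1 < q) (hδ : 0 < δ)
    (haδ : a * δ = (q - 1) / 2) (K : ℝ) :
    Tendsto (fun n : ℕ => n * (((a * Real.log n / n) * (δ * n) ^ (1 - q) +
      (a * Real.log n / n) ^ 2 * (δ * n) ^ (2 - q) *
        Real.exp ((a * Real.log n / n) * (δ * n))) * K)) atTop (𝓝 0) := by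
  have hlim : ∀ r : ℝ, 0 < r → Tendsto (fun n : ℕ => Real.log n * (n : ℝ) ^ (-r)) atTop (𝓝 0) := by
    intro r hr
    have h := ((isLittleO_log_rpow_atTop hr).tendsto_div_nhds_zero).comp
      (tendsto_natCast_atTop_atTop (R := ℝ))
    refine h.congr fun n => ?_
    simp only [Function.comp]
    rw [Real.rpow_neg (Nat.cast_nonneg _), div_eq_mul_inv]
  have h1 := hlim (q - 1) (by linarith)
  have h2 := (hlim ((q - 1) / 4) (by linarith)).pow 2
  have h3 := ((h1.const_mul a).add (h2.const_mul (a ^ 2 * δ))).const_mul (K * δ ^ (1 - q))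
  simp only [mul_zero, add_zero, ne_eq, OfNat.ofNat_ne_zero, not_false_eq_true, zero_pow] at h3
  refine h3.congr' ?_
  filter_upwards [eventually_gt_atTop 0] with n hn
  have hn' : (0 : ℝ) < n := Nat.cast_pos.2 hn
  have e1 : (δ * n) ^ (1 - q) = δ ^ (1 - q) * (n : ℝ) ^ (-(q - 1)) := by
    rw [Real.mul_rpow hδ.le hn'.le, neg_sub]
  have e2 : (δ * n) ^ (2 - q) = δ * n * (δ ^ (1 - q) * (n : ℝ) ^ (-(q - 1))) := by
    rw [← e1, show 2 - q = 1 + (1 - q) by ring, Real.rpow_add (by positivity), Real.rpow_one]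
  -- The choice of a * δ makes this factor cost only half of the decay n^(-(q-1)), leaving room for
  -- the logarithms.
  have e3 : Real.exp ((a * Real.log n / n) * (δ * n)) = (n : ℝ) ^ ((q - 1) / 2) := by
    rw [← haδ, Real.rpow_def_of_pos hn']
    congr 1
    field_simp
  have e4 : ((n : ℝ) ^ (-((q - 1) / 4))) ^ 2 =
      (n : ℝ) ^ (-(q - 1)) * (n : ℝ) ^ ((q - 1) / 2) := by
    rw [← Real.rpow_add hn', ← Real.rpow_natCast, ← Real.rpow_mul hn'.le]
    congr 1
    push_cast
    ring
  rw [e1, e2, e3, mul_pow, e4]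
  field_simp

/-- On integrating the pointwise bound, the linear term vanishes since d is centered: no recentering
after truncation is needed. Then 1 + u ≤ exp u. -/
theorem lintegral_exp_truncation_le {Ω : Type*} [MeasurableSpace Ω] (μ : Measure Ω) [IsProbabilityMeasure μ]
    {d Y : Ω → ℝ}
    (hd : Integrable d μ) (hd0 : ∫ g, d g ∂μ = 0) (hdY : ∀ g, |d g| ≤ Y g) {q l M : ℝ}
    (hq1 : 1 ≤ q) (hq2 : q ≤ 2) (hi : Integrable (fun g => Y g ^ q) μ) (hl : 0 ≤ l)
    (hM : 0 < M) :
    ∫⁻ g, ENNReal.ofReal (Real.exp (l * if Y g ≤ M then d g else 0)) ∂μ ≤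
      ENNReal.ofReal (Real.exp ((l * M ^ (1 - q) + l ^ 2 * M ^ (2 - q) * Real.exp (l * M)) *
        ∫ g, Y g ^ q ∂μ)) := by
  set c := l * M ^ (1 - q) + l ^ 2 * M ^ (2 - q) * Real.exp (l * M)
  have hb : ∀ g, Real.exp (l * if Y g ≤ M then d g else 0) ≤ 1 + l * d g + c * Y g ^ q :=
    fun g => exp_truncation_le hq1 hq2 hl hM (hdY g)
  have h1 : Integrable (fun g => 1 + l * d g) μ := (integrable_const _).add (hd.const_mul l)
  have h2 : Integrable (fun g => 1 + l * d g + c * Y g ^ q) μ := h1.add (hi.const_mul c)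
  refine (lintegral_mono fun g => ENNReal.ofReal_le_ofReal (hb g)).trans ?_
  rw [← ofReal_integral_eq_lintegral_ofReal h2
    (Eventually.of_forall fun g => (Real.exp_pos _).le.trans (hb g))]
  refine ENNReal.ofReal_le_ofReal ?_
  rw [integral_add h1 (hi.const_mul c), integral_add (integrable_const _) (hd.const_mul l),
    integral_const_mul, integral_const_mul, hd0]
  have := Real.add_one_le_exp (c * ∫ g, Y g ^ q ∂μ)
  simp only [integral_const, probReal_univ, smul_eq_mul]
  linarith

/-! ### Deviation inequalities along the walk -/

section LargeDeviations

variable {G X : Type*} [MeasurableSpace G] [MeasurableSpace X] [Monoid G] [MeasurableMul₂ G]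
  [MulAction G X]

/-- A Fuk–Nagaev type inequality along the random walk. -/
theorem measure_sum_gt_le (hsm : Measurable fun z : G × X => z.1 • z.2)
    (μ : Measure G) [IsProbabilityMeasure μ] {d : G × X → ℝ} {Y : G → ℝ} (hdm : Measurable d)
    (hYm : Measurable Y) (hdY : ∀ g x, |d (g, x)| ≤ Y g) (hYi : Integrable Y μ)
    (hd0 : ∀ x, ∫ g, d (g, x) ∂μ = 0) {q l M : ℝ} (hq1 : 1 ≤ q) (hq2 : q ≤ 2)
    (hi : Integrable (fun g => Y g ^ q) μ) (hl : 0 ≤ l) (hM : 0 < M) (n : ℕ) (r : ℝ) (x : X) :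
    (bernoulli μ).real {b | r < ∑ i ∈ Finset.range n, d (b i, walk b i • x)} ≤
      n * μ.real {g | M < Y g} +
      Real.exp (n * ((l * M ^ (1 - q) + l ^ 2 * M ^ (2 - q) * Real.exp (l * M)) *
        ∫ g, Y g ^ q ∂μ) - l * r) := by
  set w := (l * M ^ (1 - q) + l ^ 2 * M ^ (2 - q) * Real.exp (l * M)) * ∫ g, Y g ^ q ∂μ
  let t : G × X → ℝ := fun z => if Y z.1 ≤ M then d z else 0
  have htm : Measurable t := Measurable.ite
    (measurableSet_le (hYm.comp measurable_fst) measurable_const) hdm measurable_const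
  let F : G × X → ENNReal := fun z => ENNReal.ofReal (Real.exp (l * t z))
  have hF : Measurable F := (htm.const_mul l).exp.ennreal_ofReal
  have hdi : ∀ x, Integrable (fun g => d (g, x)) μ := fun x =>
    hYi.mono' (hdm.comp measurable_prodMk_right).aestronglyMeasurable
      (Eventually.of_forall fun g => hdY g x)
  have hlap := lintegral_prod_trajectory_le hsm μ hF (fun x =>
    lintegral_exp_truncation_le μ (hdi x) (hd0 x) (fun g => hdY g x) hq1 hq2 hi hl hM) n x
  -- Either some letter exceeds the truncation level, or truncation changes nothing and Markov's
  -- inequality applies to the exponential.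
  have hsub : {b : ℕ → G | r < ∑ i ∈ Finset.range n, d (b i, walk b i • x)} ⊆
      (⋃ i ∈ Finset.range n, {b : ℕ → G | b i ∈ {g | M < Y g}}) ∪
        {b | ENNReal.ofReal (Real.exp (l * r)) ≤
          ∏ i ∈ Finset.range n, F (b i, walk b i • x)} := by
    intro b hb
    by_cases h : ∃ i ∈ Finset.range n, M < Y (b i)
    · left
      simpa using h
    · right
      push Not at h
      have ht : ∀ i ∈ Finset.range n, t (b i, walk b i • x) = d (b i, walk b i • x) :=
        fun i hi => if_pos (h i hi)
      simp only [mem_ofPred_eq, F]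
      rw [← ENNReal.ofReal_prod_of_nonneg fun i _ => (Real.exp_pos _).le, ← Real.exp_sum,
        ← Finset.mul_sum, Finset.sum_congr rfl ht]
      refine ENNReal.ofReal_le_ofReal (Real.exp_le_exp.2 ?_)
      exact mul_le_mul_of_nonneg_left (le_of_lt hb) hl
  refine (measureReal_mono hsub).trans ((measureReal_union_le _ _).trans (add_le_add ?_ ?_))
  · refine (measureReal_biUnion_finset_le _ _).trans ?_
    have hms : MeasurableSet {g | M < Y g} := measurableSet_lt measurable_const hYm
    simp only [Measure.real, bernoulli_eval μ _ hms]
    simp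
  · have hmk := mul_meas_ge_le_lintegral (μ := bernoulli μ)
      (Finset.measurable_fun_prod (Finset.range n) fun i _ =>
        hF.comp (measurable_trajectory hsm i x)) (ENNReal.ofReal (Real.exp (l * r)))
    have h2 := hmk.trans hlap
    rw [← ENNReal.ofReal_pow (Real.exp_pos _).le, ← Real.exp_nat_mul] at h2
    have h3 := ENNReal.toReal_mono ENNReal.ofReal_ne_top h2
    rw [ENNReal.toReal_mul, ENNReal.toReal_ofReal (Real.exp_pos _).le,
      ENNReal.toReal_ofReal (Real.exp_pos _).le] at h3
    rw [Real.exp_sub, le_div_iff₀ (Real.exp_pos _), mul_comm]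
    exact h3

/-- A Baum–Katz theorem along the random walk, for centered increments dominated by a function
of the letter alone. -/
theorem exists_summable_bound_sum_gt (hsm : Measurable fun z : G × X => z.1 • z.2)
    (μ : Measure G) [IsProbabilityMeasure μ] {d : G × X → ℝ} {Y : G → ℝ} (hdm : Measurable d)
    (hYm : Measurable Y) (hY0 : ∀ g, 0 ≤ Y g) (hdY : ∀ g x, |d (g, x)| ≤ Y g)
    (hd0 : ∀ x, ∫ g, d (g, x) ∂μ = 0) {p : ℝ} (hp : 1 < p)
    (hLp : MemLp Y (ENNReal.ofReal p) μ) {η : ℝ} (hη : 0 < η) :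
    ∃ D : ℕ → ℝ, (∀ n, 0 ≤ D n) ∧ Summable (fun n : ℕ => (n : ℝ) ^ (p - 2) * D n) ∧
      ∀ᶠ n : ℕ in atTop, ∀ x : X, (bernoulli μ).real
        {b | η * n < ∑ i ∈ Finset.range n, d (b i, walk b i • x)} ≤ D n := by
  have hint : ∀ r : ℝ, 0 < r → r ≤ p → Integrable (fun g => Y g ^ r) μ := by
    intro r hr hrp
    have h := (hLp.mono_exponent (ENNReal.ofReal_le_ofReal hrp)).integrable_norm_rpow
      (by simpa using hr) ENNReal.ofReal_ne_top
    simpa only [Real.norm_of_nonneg (hY0 _), ENNReal.toReal_ofReal hr.le] using h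
  have hYi : Integrable Y μ := by simpa using hint 1 one_pos hp.le
  -- The quadratic bound on exp uses moments of order at most 2.
  set q := min p 2
  have hq1 : 1 < q := lt_min hp one_lt_two
  -- With l = a log n / n, this gives exp(-l η n) = n^(-p).
  set a := p / η
  have ha : 0 < a := div_pos (by linarith) hη
  set δ := (q - 1) / 2 / a
  have hδ : 0 < δ := div_pos (by linarith) ha
  have haδ : a * δ = (q - 1) / 2 := mul_div_cancel₀ _ ha.ne'
  -- The factor `exp 1` absorbs the Laplace exponent, which tends to 0 and so is eventually at most
  -- 1.
  refine ⟨fun n => n * μ.real {g | δ * n < Y g} + Real.exp 1 * (n : ℝ) ^ (-p),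
    fun n => by positivity, ?_, ?_⟩
  · have h1 := summable_rpow_mul_measure_lt hp hYm hY0 (hint p (by linarith) le_rfl) hδ
    have h2 : Summable fun n : ℕ => Real.exp 1 * (n : ℝ) ^ (-2 : ℝ) :=
      (Real.summable_nat_rpow.2 (by norm_num)).mul_left _
    refine (summable_congr_atTop ?_).1 (h1.add h2)
    filter_upwards [eventually_gt_atTop 0] with n hn
    have hn' : (0 : ℝ) < n := Nat.cast_pos.2 hn
    rw [show p - 1 = (p - 2) + 1 by ring, Real.rpow_add hn', Real.rpow_one,
      show (-2 : ℝ) = (p - 2) + -p by ring, Real.rpow_add hn']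
    ring
  · have hlim := tendsto_laplace_exponent hq1 hδ haδ (∫ g, Y g ^ q ∂μ)
    filter_upwards [hlim.eventually_le_const one_pos, eventually_gt_atTop 0] with n hn hn0 x
    have hn' : (0 : ℝ) < n := Nat.cast_pos.2 hn0
    refine (measure_sum_gt_le hsm μ hdm hYm hdY hYi hd0 hq1.le (min_le_right _ _)
      (hint q (by linarith) (min_le_left _ _)) (l := a * Real.log n / n) (M := δ * n)
      (div_nonneg (mul_nonneg ha.le (Real.log_natCast_nonneg n)) hn'.le)
      (mul_pos hδ hn') n (η * n) x).trans ?_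
    gcongr
    rw [Real.rpow_def_of_pos hn', ← Real.exp_add]
    refine Real.exp_le_exp.2 ?_
    have : a * Real.log n / n * (η * n) = Real.log n * p := by
      simp only [a]
      field_simp
    rw [this]
    linarith

end LargeDeviations

/-! ### Sign symmetry, finitely many terms, and cocycles -/

theorem upperAverage_neg {G X : Type*} [MeasurableSpace G] [MeasurableSpace X] [SMul G X]
    (μ : Measure G) (σ : G × X → ℝ) :
    upperAverage μ (-σ) = -lowerAverage μ σ := by
  have : stationaryAverages μ (-σ) = -stationaryAverages μ σ := by
    ext a
    simp only [stationaryAverages, mem_ofPred_eq, Set.mem_neg, Pi.neg_apply, integral_neg,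
      neg_eq_iff_eq_neg]
  rw [upperAverage, this, lowerAverage, Real.sInf_def, neg_neg]

theorem ergodicAverage_neg {G X : Type*} [Monoid G] [MulAction G X] (σ : G × X → ℝ) (n : ℕ) (x : X)
    (b : ℕ → G) :
    ergodicAverage (-σ) n x b = -ergodicAverage σ n x b := by
  simp [ergodicAverage, neg_div]

/-- A bound which holds for large `n` holds for all `n` after a modification of finitely many
terms. -/
theorem exists_summable_bound_of_eventually {ι : Type*} {f : ℕ → ι → ℝ}
    (hf : ∀ n x, f n x ≤ 1) {c D : ℕ → ℝ} (hD0 : ∀ n, 0 ≤ D n)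
    (hDs : Summable fun n => c n * D n) (hD : ∀ᶠ n in atTop, ∀ x, f n x ≤ D n) :
    ∃ D' : ℕ → ℝ, (∀ n, 0 ≤ D' n) ∧ Summable (fun n => c n * D' n) ∧ ∀ n x, f n x ≤ D' n := by
  obtain ⟨N, hN⟩ := eventually_atTop.1 hD
  refine ⟨fun n => if n < N then 1 else D n, fun n => ?_, ?_, fun n x => ?_⟩
  · dsimp only
    split_ifs
    exacts [zero_le_one, hD0 n]
  · refine (summable_congr_atTop ?_).1 hDs
    filter_upwards [eventually_ge_atTop N] with n hn
    rw [if_neg hn.not_gt]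
  · dsimp only
    split_ifs with h
    exacts [hf n x, hN n (not_lt.1 h) x]

theorem IsCocycle.sum_trajectory {G X : Type*} [Monoid G] [MulAction G X] {σ : G × X → ℝ}
    (h : IsCocycle σ) (b : ℕ → G) (x : X) (n : ℕ) :
    ∑ i ∈ Finset.range n, σ (b i, walk b i • x) = σ (walk b n, x) := by
  induction n with
  | zero =>
    -- The cocycle relation forces σ(1, x) = 0, the value for the empty sum.
    have := h 1 1 x
    simp only [one_smul, mul_one] at this
    simp only [Finset.range_zero, Finset.sum_empty, walk]
    linarith
  | succ n ih => rw [Finset.sum_range_succ, ih, walk, h, add_comm]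

/-! ### Martingale decomposition and conclusion -/

section Stationary

variable {G : Type*} [Monoid G] [TopologicalSpace G] [ContinuousMul G]
  [SecondCountableTopology G] [MeasurableSpace G] [BorelSpace G]
  {X : Type*} [TopologicalSpace X] [CompactSpace X] [TopologicalSpace.MetrizableSpace X]
  [MeasurableSpace X] [BorelSpace X] [MulAction G X] [ContinuousSMul G X]

/-- The martingale increment of the random walk obtained from `σ` by subtracting its drift and
adding the coboundary of `ψ`. -/
noncomputable def increment (μ : Measure G) [IsProbabilityMeasure μ] (σ : G × X → ℝ)
    (φ ψ : C(X, ℝ)) (z : G × X) : ℝ :=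
  σ z - φ z.2 + (ψ (z.1 • z.2) - markovOp μ ψ z.2)

theorem sum_trajectory_eq (μ : Measure G) [IsProbabilityMeasure μ] (σ : G × X → ℝ)
    (φ ψ : C(X, ℝ)) (b : ℕ → G) (x : X) (n : ℕ) :
    ∑ i ∈ Finset.range n, σ (b i, walk b i • x) =
      ∑ i ∈ Finset.range n, increment μ σ φ ψ (b i, walk b i • x) +
      ∑ i ∈ Finset.range n, (φ (walk b i • x) - (ψ (walk b i • x) - markovOp μ ψ (walk b i • x))) +
      (ψ x - ψ (walk b n • x)) := by
  induction n with
  | zero => simp [walk]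
  | succ n ih =>
    simp only [Finset.sum_range_succ, ih, increment, walk, mul_smul]
    ring

theorem abs_increment_le (μ : Measure G) [IsProbabilityMeasure μ] {σ : G × X → ℝ}
    (hσ : Continuous σ) (φ ψ : C(X, ℝ)) (g : G) (x : X) :
    |increment μ σ φ ψ (g, x)| ≤ supNorm σ g + (‖φ‖ + 2 * ‖ψ‖) := by
  have h1 := abs_le_supNorm hσ g x
  have h2 : |φ x| ≤ ‖φ‖ := φ.norm_coe_le_norm x
  have h3 : |ψ (g • x)| ≤ ‖ψ‖ := ψ.norm_coe_le_norm _
  have h4 : |markovOp μ ψ x| ≤ ‖ψ‖ :=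
    ((markovOp μ ψ).norm_coe_le_norm x).trans (by simpa using norm_markovOp_pow_le μ ψ 1)
  rw [abs_le] at *
  simp only [increment]
  constructor <;> linarith

/-- This is the martingale property: given the current position, both σ and ψ(g x) are centered by
their conditional means. -/
theorem integral_increment (μ : Measure G) [IsProbabilityMeasure μ] {σ : G × X → ℝ}
    (hσ : Continuous σ) (hi : Integrable (supNorm σ) μ) (ψ : C(X, ℝ)) (x : X) :
    ∫ g, increment μ σ (drift μ σ hσ hi) ψ (g, x) ∂μ = 0 := by
  have h1 := integrable_section hσ hi x
  have h2 := integrable_comp_smul (μ := μ) ψ x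
  have h3 : Integrable (fun g => σ (g, x) - drift μ σ hσ hi x) μ := h1.sub (integrable_const _)
  have h4 : Integrable (fun g => ψ (g • x) - markovOp μ ψ x) μ := h2.sub (integrable_const _)
  simp only [increment]
  rw [integral_add h3 h4, integral_sub h1 (integrable_const _),
    integral_sub h2 (integrable_const _)]
  simp [drift, markovOp_apply]

/-- The margin ε is split into three: the martingale, the corrected drift, and the boundary term,
which is below εn/3 for large n. -/
theorem exists_summable_bound_average_gt (μ : Measure G) [IsProbabilityMeasure μ] {p : ℝ}
    (hp : 1 < p) {σ : G × X → ℝ} (hσ : Continuous σ)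
    (hLp : MemLp (supNorm σ) (ENNReal.ofReal p) μ) {ε : ℝ} (hε : 0 < ε) :
    ∃ D : ℕ → ℝ, (∀ n, 0 ≤ D n) ∧ Summable (fun n : ℕ => (n : ℝ) ^ (p - 2) * D n) ∧
      ∀ᶠ n : ℕ in atTop, ∀ x : X, (bernoulli μ).real
        {b | upperAverage μ σ + ε < ergodicAverage σ n x b} ≤ D n := by
  have hi : Integrable (supNorm σ) μ := hLp.integrable (by simpa using hp.le)
  set φ := drift μ σ hσ hi
  have hε3 : 0 < ε / 3 := by linarith
  obtain ⟨N, hN⟩ := exists_average_drift_le hσ hi hε3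
  obtain ⟨ψ, hψ⟩ := exists_poisson μ φ N
  have hdm : Measurable (increment μ σ φ ψ) := by
    have : Continuous (increment μ σ φ ψ) := by
      unfold increment
      fun_prop
    exact this.measurable
  obtain ⟨D, hD0, hDs, hD⟩ := exists_summable_bound_sum_gt measurable_smul_prod μ hdm
    ((continuous_supNorm hσ).measurable.add_const (‖φ‖ + 2 * ‖ψ‖))
    (fun g => add_nonneg (supNorm_nonneg σ g) (by positivity))
    (abs_increment_le μ hσ φ ψ) (integral_increment μ hσ hi ψ) hp
    (hLp.add (memLp_const _)) hε3
  refine ⟨D, hD0, hDs, ?_⟩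
  have hlarge : ∀ᶠ n : ℕ in atTop, 2 * ‖ψ‖ ≤ ε / 3 * n :=
    (tendsto_natCast_atTop_atTop.const_mul_atTop hε3).eventually_ge_atTop _
  filter_upwards [hD, hlarge, eventually_gt_atTop 0] with n hn hnψ hn0 x
  have hn' : (0 : ℝ) < n := Nat.cast_pos.2 hn0
  refine (measureReal_mono fun b hb => ?_).trans (hn x)
  simp only [mem_ofPred_eq, ergodicAverage] at hb ⊢
  rw [lt_div_iff₀ hn', sum_trajectory_eq μ σ φ ψ] at hb
  have h1 : ∑ i ∈ Finset.range n,
      (φ (walk b i • x) - (ψ (walk b i • x) - markovOp μ ψ (walk b i • x))) ≤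
      n * (upperAverage μ σ + ε / 3) := by
    refine (Finset.sum_le_card_nsmul _ _ (upperAverage μ σ + ε / 3) fun i _ => ?_).trans ?_
    -- By the Poisson equation the corrected drift is the Cesàro average, which is bounded
    -- pointwise.
    · rw [hψ]
      linarith [hN (walk b i • x)]
    · rw [Finset.card_range, nsmul_eq_mul]
  have h2 : |ψ x| ≤ ‖ψ‖ := ψ.norm_coe_le_norm x
  have h3 : |ψ (walk b n • x)| ≤ ‖ψ‖ := ψ.norm_coe_le_norm _
  rw [abs_le] at h2 h3
  linarith

theorem exists_summable_bound_average_notMem (μ : Measure G) [IsProbabilityMeasure μ] {p : ℝ}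
    (hp : 1 < p) {σ : G × X → ℝ} (hσ : Continuous σ)
    (hLp : MemLp (supNorm σ) (ENNReal.ofReal p) μ) {ε : ℝ} (hε : 0 < ε) :
    ∃ D : ℕ → ℝ, (∀ n, 0 ≤ D n) ∧ Summable (fun n : ℕ => (n : ℝ) ^ (p - 2) * D n) ∧
      ∀ n : ℕ, ∀ x : X, (bernoulli μ).real {b | ergodicAverage σ n x b ∉
        Icc (lowerAverage μ σ - ε) (upperAverage μ σ + ε)} ≤ D n := by
  obtain ⟨D, hD0, hDs, hD⟩ := exists_summable_bound_average_gt μ hp hσ hLp hε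
  obtain ⟨E, hE0, hEs, hE⟩ := exists_summable_bound_average_gt μ hp hσ.neg
    (by rwa [supNorm_neg]) hε
  refine exists_summable_bound_of_eventually (fun n x => measureReal_le_one)
    (D := fun n => D n + E n) (fun n => add_nonneg (hD0 n) (hE0 n))
    (by simpa only [mul_add] using hDs.add hEs) ?_
  filter_upwards [hD, hE] with n hDn hEn x
  refine le_trans ?_ (add_le_add (hDn x) (hEn x))
  refine (measureReal_mono fun b hb => ?_).trans (measureReal_union_le _ _)
  simp only [mem_ofPred_eq, mem_Icc, not_and_or, not_le] at hb
  rcases hb with hb | hb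
  · right
    rw [mem_ofPred_eq, upperAverage_neg, ergodicAverage_neg]
    linarith
  · exact Or.inl hb

theorem IsCocycle.convPow_real_eq (μ : Measure G) [IsProbabilityMeasure μ] {σ : G × X → ℝ}
    (h : IsCocycle σ) (hσ : Continuous σ) {s : Set ℝ} (hs : MeasurableSet s) (n : ℕ) (x : X) :
    (convPow μ n).real {g | σ (g, x) / n ∈ s} =
      (bernoulli μ).real {b | ergodicAverage σ n x b ∈ s} := by
  have hc : Continuous fun g => σ (g, x) := by fun_prop
  have hm : Measurable fun g => σ (g, x) / n := hc.measurable.div_const _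
  have hms : MeasurableSet {g | σ (g, x) / n ∈ s} := hm hs
  rw [← map_walk, map_measureReal_apply (measurable_walk n) hms]
  simp only [ergodicAverage, h.sum_trajectory]
  rfl

end Stationary

end RandomWalk

theorem proposition3p2
    {G : Type*} [Group G] [TopologicalSpace G] [IsTopologicalGroup G]
    [LocallyCompactSpace G] [SecondCountableTopology G] [MeasurableSpace G] [BorelSpace G]
    {X : Type*} [TopologicalSpace X] [CompactSpace X] [TopologicalSpace.MetrizableSpace X]
    [MeasurableSpace X] [BorelSpace X] [MulAction G X] [ContinuousSMul G X]
    (μ : Measure G) [IsProbabilityMeasure μ] (p : ℝ) (hp : 1 < p)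
    (σ : G × X → ℝ) (hσ : Continuous σ)
    (hLp : MemLp (RandomWalk.supNorm σ) (ENNReal.ofReal p) μ)
    (ε : ℝ) (hε : 0 < ε) :
    ∃ D : ℕ → ℝ,
      (∀ n, 0 ≤ D n) ∧
      Summable (fun n : ℕ+ => ((n : ℕ) : ℝ) ^ (p - 2) * D n) ∧
      (∀ n : ℕ, 1 ≤ n → ∀ x : X,
        (RandomWalk.bernoulli μ).real
          {b | RandomWalk.ergodicAverage σ n x b ∉
            Icc (RandomWalk.lowerAverage μ σ - ε) (RandomWalk.upperAverage μ σ + ε)} ≤ D n) ∧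
      (RandomWalk.IsCocycle σ → ∀ n : ℕ, 1 ≤ n → ∀ x : X,
        (RandomWalk.convPow μ n).real
          {g | σ (g, x) / n ∉
            Icc (RandomWalk.lowerAverage μ σ - ε) (RandomWalk.upperAverage μ σ + ε)} ≤ D n) := by
  obtain ⟨D, hD0, hDs, hD⟩ := RandomWalk.exists_summable_bound_average_notMem μ hp hσ hLp hε
  refine ⟨D, hD0, hDs.comp_injective PNat.coe_injective, fun n _ x => hD n x,
    fun hcoc n _ x => ?_⟩
  exact (hcoc.convPow_real_eq μ hσ measurableSet_Icc.compl n x).trans_le (hD n x)
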